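/- **Game.** Let $\mathcal N=\{1,\dots,N\}$, $N\ge 1$, be the players. Player $i$ has a nonempty, closed, convex and bounded strategy set $\mathcal X_i\subset\mathbb R^{n_i}$ and an objective $J_i(x^i;x^{-i})$ that is continuously differentiable on $\mathcal X=\prod_i\mathcal X_i$. The game is a potential game: there is $\Phi:\mathcal X\to\mathbb R$ with $J_i(x^i;x^{-i})-J_i(w^i;x^{-i})=\Phi(x^i,x^{-i})-\Phi(w^i,x^{-i})$ for all $i$, all $x^i,w^i\in\mathcal X_i$ and all $x^{-i}$. The potential $\Phi$ is convex and $L$-smooth ($L>0$) on $\mathcal X$ with respect to a norm $\|\cdot\|$ on $\prod_i\mathbb R^{n_i}$, that is, $\|\nabla\Phi(x)-\nabla\Phi(x')\|_*\le L\|x-x'\|$ on $\mathcal X$. Each player has a regularizer $\psi_i:\mathcal X_i\to\mathbb R$ that is continuous on $\mathcal X_i$ and $\mu_i$-strongly convex ($\mu_i>0$) with respect to a norm on $\mathbb R^{n_i}$; the norms are arbitrary. Put $\mu_*=\min_i\mu_i$ and $\nabla\psi_i^*(z)=\operatorname{argmax}_{u\in\mathcal X_i}\{\langle z,u\rangle-\psi_i(u)\}$.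 **Delays and step sizes.** The feedback of player $i$ generated at iteration $k\ge 1$ has the delay $d^i_k\ge 0$, and $d^i_k\le D\,k^{\alpha}$ for all $i$ and $k\ge1$, where $D>0$ and $0\le\alpha<1$. The step sizes are $a_k=a_0k^{\beta}$ with $a_0>0$ and $0\le\beta\le 1$, where $\alpha$ and $\beta$ are not both $0$. With $A_k=\sum_{t=1}^k a_t$ ($A_0=0$), it is assumed that $a_k^2/A_k\le\mu_*/L$ for all $k\ge1$. **Algorithm.** Start from $x_0=x_1\in\mathcal X$ such that each $\psi_i$ is differentiable at $x^i_0$, $z^i_0=\nabla\psi_i(x^i_0)$, $y_0=0$ and $s^i(0)=1$, and write $g^i_t=\nabla_{x^i}J_i(x_t^i;x_t^{-i})$. At iteration $k=1,2,\dots$ each player $i$ receives the feedback with the time stamps $\mathcal R^i_k=\{t\ge1:\ k-1<t+d^i_t\le k\}$ and sets $s^i(k)=\max\mathcal R^i_k$ if $\mathcal R^i_k\neq\varnothing$ and $\max\mathcal R^i_k>s^i(k-1)$, and $s^i(k)=s^i(k-1)$ otherwise. Then $$z^i_k=z^i_{k-1}-a_k\,g^i_{s^i(k)},\qquad y^i_k=\tfrac{A_{k-1}}{A_k}y^i_{k-1}+\tfrac{a_k}{A_k}\nabla\psi_i^*(z^i_k),\qquad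 x^i_{k+1}=\tfrac{A_k}{A_{k+1}}y^i_k+\tfrac{a_{k+1}}{A_{k+1}}\nabla\psi_i^*(z^i_k).$$ **Theorem.** For every minimizer $x_*$ of $\Phi$ over $\mathcal X$, $$\Phi(y_k)-\Phi(x_*)=O\!\left(\frac1{k^{1-\alpha}}\right)\qquad(k\to\infty).$$ -/

import Mathlib

open Filter Topology Asymptotics

noncomputable section

namespace DelayGame

variable {ι : Type*} {E : ι → Type*} [∀ i, NormedAddCommGroup (E i)] [∀ i, NormedSpace ℝ (E i)]

/-- The joint strategy space `∏ i, X i`. -/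
def jointSpace (X : ∀ i, Set (E i)) : Set (∀ i, E i) := Set.univ.pi X

/-- `Φ` is a potential function of the game with strategy sets `X i` and objectives `J i`:
a unilateral change of strategy changes the objective of the deviating player by exactly
as much as it changes `Φ`. -/
def IsPotential [DecidableEq ι] (X : ∀ i, Set (E i)) (J : ι → (∀ i, E i) → ℝ)
    (Φ : (∀ i, E i) → ℝ) : Prop :=
  ∀ i, ∀ x ∈ jointSpace X, ∀ u ∈ X i, ∀ w ∈ X i,
    J i (Function.update x i u) - J i (Function.update x i w) =
      Φ (Function.update x i u) - Φ (Function.update x i w)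

/-- `f` is `L`-smooth on `S` with respect to the norm `p`: it is differentiable on `S` with a
gradient that is `L`-Lipschitz from `p` to the dual norm of `p`. The dual norm bound
`‖G x - G x'‖_* ≤ L * p (x - x')` is written out by pairing with all vectors `h`. -/
def IsSmoothOn {V : Type*} [NormedAddCommGroup V] [NormedSpace ℝ V] (p : Seminorm ℝ V)
    (L : ℝ) (S : Set V) (f : V → ℝ) : Prop :=
  ∃ G : V → (V →L[ℝ] ℝ), (∀ x ∈ S, HasFDerivWithinAt f (G x) S x) ∧
    ∀ x ∈ S, ∀ x' ∈ S, ∀ h : V, |(G x - G x') h| ≤ L * p (x - x') * p h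

/-- The mirror map of the regularizer `ψ` on `S`, `z ↦ argmax_{u ∈ S} (⟨z, u⟩ - ψ u)`,
as the set of maximizers (a single point if `S` is compact, convex and nonempty and `ψ` is
continuous and strongly convex on `S`). -/
def mirrorMap {V : Type*} [NormedAddCommGroup V] [NormedSpace ℝ V] (S : Set V) (ψ : V → ℝ)
    (z : V →L[ℝ] ℝ) : Set V :=
  {v | v ∈ S ∧ IsMaxOn (fun u => z u - ψ u) S v}

/-- The step sizes `a_k = a₀ k^β`. -/
def stepSize (a₀ β : ℝ) (k : ℕ) : ℝ := a₀ * (k : ℝ) ^ β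

/-- The accumulated step sizes `A_k = ∑_{t = 1}^k a_t`. -/
def cumStep (a : ℕ → ℝ) (k : ℕ) : ℝ := ∑ t ∈ Finset.Icc 1 k, a t

open Classical in
/-- The time stamps `t ≥ 1` of the feedback that arrives at iteration `k` if the feedback of
iteration `t` is delayed by `δ t ≥ 0`, i.e. those with `k - 1 < t + δ t ≤ k`. -/
def received (δ : ℕ → ℝ) (k : ℕ) : Finset ℕ :=
  (Finset.Icc 1 k).filter fun t => (k : ℝ) - 1 < t + δ t ∧ t + δ t ≤ k

open Classical in
/-- The time stamp `s(k)` of the feedback that is used at iteration `k`: the most recent one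
(with respect to the iteration it originates from) among those received so far, and `1` if
nothing has been received yet. -/
def source (δ : ℕ → ℝ) : ℕ → ℕ
  | 0 => 1
  | k + 1 =>
    if h : (received δ (k + 1)).Nonempty then
      if source δ k < (received δ (k + 1)).max' h then (received δ (k + 1)).max' h
      else source δ k
    else source δ k

/-- `x, y, z, v, g` are generated by the delayed-feedback accelerated method, where `d i k` is
the delay of the feedback of player `i` of iteration `k`, `g k i` is the partial gradient of
`J i` in the player's own variable at `x k`, and `v k i` is the mirror image of `z k i`. -/
structure IsRun [DecidableEq ι] (X : ∀ i, Set (E i)) (J : ι → (∀ i, E i) → ℝ)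
    (ψ : ∀ i, E i → ℝ) (a : ℕ → ℝ) (d : ι → ℕ → ℝ) (x y v : ℕ → ∀ i, E i)
    (z g : ℕ → ∀ i, E i →L[ℝ] ℝ) : Prop where
  x_zero_mem : x 0 ∈ jointSpace X
  x_one : x 1 = x 0
  y_zero : y 0 = 0
  z_zero : ∀ i, HasFDerivWithinAt (ψ i) (z 0 i) (X i) (x 0 i)
  feedback : ∀ k, 1 ≤ k → ∀ i,
    HasFDerivWithinAt (fun u => J i (Function.update (x k) i u)) (g k i) (X i) (x k i)
  z_step : ∀ k i, z (k + 1) i = z k i - a (k + 1) • g (source (d i) (k + 1)) i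
  mirror : ∀ k, 1 ≤ k → ∀ i, v k i ∈ mirrorMap (X i) (ψ i) (z k i)
  y_step : ∀ k i, y (k + 1) i =
    (cumStep a k / cumStep a (k + 1)) • y k i + (a (k + 1) / cumStep a (k + 1)) • v (k + 1) i
  x_step : ∀ k, 1 ≤ k → ∀ i, x (k + 1) i =
    (cumStep a k / cumStep a (k + 1)) • y k i + (a (k + 1) / cumStep a (k + 1)) • v k i

end DelayGame

end

/-! Write `A_k` for `cumStep`. The averages satisfy `A_{k+1} y_{k+1} = A_k y_k + a_{k+1} v_{k+1}`,
so convexity of `Φ` at each `y_t` telescopes to `A_k (Φ(y_k) - Φ(x_*)) ≤ ∑ a_t ⟨∇Φ(y_t), v_t - x_*⟩`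
(`cumStep_mul_gap_le`). With the delayed gradients in place of `∇Φ(y_t)`, the sum is bounded by a
constant: `v_t` is the mirror image of the dual point that already contains the gradient of step
`t`, so be-the-leader applies (`sum_mul_apply_sub_le`). By smoothness and boundedness the
replacement costs a multiple of `p (y_t - x_s)` per player. That player's source `s` lags by
`O(t^α)` iterations (`sub_source_le`), each moving the average by `O(1/t)`, so the distance is
`O(t^(α-1))` (`IsRun.seminorm_y_sub_x_source_le`). Thus `A_k` times the gap is `O(1) + O(∑
t^(α+β-1)) = O(k^(α+β))`, and `A_k ≥ (a₀/2) k^(β+1)` gives the rate. -/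

namespace DelayGame

/-! ### Growth of the step sizes and power sums. -/

section StepSizes

variable {a₀ β : ℝ}

lemma stepSize_pos (ha₀ : 0 < a₀) {k : ℕ} (hk : 1 ≤ k) : 0 < stepSize a₀ β k :=
  mul_pos ha₀ (Real.rpow_pos_of_pos (by exact_mod_cast hk) _)

lemma cumStep_zero (a : ℕ → ℝ) : cumStep a 0 = 0 := by simp [cumStep]

lemma cumStep_succ (a : ℕ → ℝ) (k : ℕ) : cumStep a (k + 1) = cumStep a k + a (k + 1) :=
  Finset.sum_Icc_succ_top (by omega) _

lemma cumStep_nonneg {a : ℕ → ℝ} (ha : ∀ k, 1 ≤ k → 0 < a k) (k : ℕ) : 0 ≤ cumStep a k :=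
  Finset.sum_nonneg fun t ht => (ha t (Finset.mem_Icc.1 ht).1).le

lemma cumStep_succ_pos {a : ℕ → ℝ} (ha : ∀ k, 1 ≤ k → 0 < a k) (k : ℕ) :
    0 < cumStep a (k + 1) := by
  rw [cumStep_succ]
  exact add_pos_of_nonneg_of_pos (cumStep_nonneg ha k) (ha _ (by omega))

/-- As `t^(β-1)` is nonincreasing for `β ≤ 1`, each `a_t` dominates the linear term `a₀ k^(β-1) t`,
and these sum in closed form. -/
lemma le_cumStep_stepSize (ha₀ : 0 < a₀) (hβ1 : β ≤ 1) {k : ℕ} (hk : 1 ≤ k) :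
    a₀ / 2 * (k : ℝ) ^ (β + 1) ≤ cumStep (stepSize a₀ β) k := by
  have hk0 : (0 : ℝ) < k := by exact_mod_cast hk
  have hterm : ∀ t ∈ Finset.Icc 1 k,
      a₀ * (k : ℝ) ^ (β - 1) * t ≤ stepSize a₀ β t := by
    intro t ht
    obtain ⟨h1, h2⟩ := Finset.mem_Icc.1 ht
    have ht0 : (0 : ℝ) < t := by exact_mod_cast h1
    have h : (k : ℝ) ^ (β - 1) ≤ (t : ℝ) ^ (β - 1) :=
      Real.rpow_le_rpow_of_nonpos ht0 (by exact_mod_cast h2) (by linarith)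
    have e : (t : ℝ) ^ β = (t : ℝ) ^ (β - 1) * t := by
      rw [← Real.rpow_add_one ht0.ne']; ring_nf
    rw [stepSize, e, mul_assoc]
    gcongr
  have hsum : ∀ n : ℕ, ∑ t ∈ Finset.Icc 1 n, (t : ℝ) = n * (n + 1) / 2 := by
    intro n
    induction n with
    | zero => simp
    | succ n ih => rw [Finset.sum_Icc_succ_top (by omega), ih]; push_cast; ring
  have h := Finset.sum_le_sum hterm
  rw [← Finset.mul_sum, hsum] at h
  refine le_trans ?_ h
  have e : (k : ℝ) ^ (β + 1) = (k : ℝ) ^ (β - 1) * (k * k) := by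
    rw [← mul_assoc, ← Real.rpow_add_one hk0.ne', ← Real.rpow_add_one hk0.ne']; ring_nf
  rw [e]
  have := mul_pos ha₀ (Real.rpow_pos_of_pos hk0 (β - 1))
  nlinarith [mul_pos this hk0]

lemma stepSize_div_cumStep_le (ha₀ : 0 < a₀) (hβ1 : β ≤ 1) {k : ℕ} (hk : 1 ≤ k) :
    stepSize a₀ β k / cumStep (stepSize a₀ β) k ≤ 2 / k := by
  have hk0 : (0 : ℝ) < k := by exact_mod_cast hk
  have hA := le_cumStep_stepSize ha₀ hβ1 hk
  have hpos : 0 < a₀ / 2 * (k : ℝ) ^ (β + 1) := by positivity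
  rw [div_le_div_iff₀ (hpos.trans_le hA) hk0]
  rw [Real.rpow_add_one hk0.ne'] at hA
  rw [stepSize]
  linarith

/-- For `γ ≥ 1` the last term is the largest; for `γ ≤ 1` Bernoulli's inequality gives `γ m^(γ-1) ≤
m^γ - (m-1)^γ`, which telescopes. The constant covers both cases. -/
lemma sum_rpow_sub_one_le {γ : ℝ} (hγ : 0 < γ) (k : ℕ) :
    ∑ t ∈ Finset.Icc 1 k, (t : ℝ) ^ (γ - 1) ≤ (1 + 1 / γ) * (k : ℝ) ^ γ := by
  rcases le_total 1 γ with h | h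
  · rcases Nat.eq_zero_or_pos k with rfl | hk
    · simp [Real.zero_rpow hγ.ne']
    have hk0 : (0 : ℝ) < k := by exact_mod_cast hk
    have hle : ∀ t ∈ Finset.Icc 1 k, (t : ℝ) ^ (γ - 1) ≤ (k : ℝ) ^ (γ - 1) := fun t ht =>
      Real.rpow_le_rpow (by positivity) (by exact_mod_cast (Finset.mem_Icc.1 ht).2) (by linarith)
    have hs := Finset.sum_le_card_nsmul _ _ _ hle
    rw [Nat.card_Icc, nsmul_eq_mul, Nat.add_sub_cancel, mul_comm,
      ← Real.rpow_add_one hk0.ne', sub_add_cancel] at hs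
    have : 0 ≤ 1 / γ * (k : ℝ) ^ γ := by positivity
    linarith
  · suffices H : ∑ t ∈ Finset.Icc 1 k, (t : ℝ) ^ (γ - 1) ≤ 1 / γ * (k : ℝ) ^ γ by
      have : 0 ≤ (k : ℝ) ^ γ := by positivity
      linarith
    induction k with
    | zero => simp [Real.zero_rpow hγ.ne']
    | succ n ih =>
      rw [Finset.sum_Icc_succ_top (by omega)]
      have hm : (0 : ℝ) < (n + 1 : ℕ) := by positivity
      have hs : (-1 : ℝ) ≤ -1 / ((n + 1 : ℕ) : ℝ) := by
        rw [le_div_iff₀ hm]; push_cast; linarith [(Nat.cast_nonneg n : (0 : ℝ) ≤ n)]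
      have hb := rpow_one_add_le_one_add_mul_self hs hγ.le h
      have e1 : 1 + -1 / ((n + 1 : ℕ) : ℝ) = n / ((n + 1 : ℕ) : ℝ) := by
        field_simp; push_cast; ring
      rw [e1, Real.div_rpow (by positivity) hm.le, div_le_iff₀ (by positivity)] at hb
      have e2 : ((n + 1 : ℕ) : ℝ) ^ γ = ((n + 1 : ℕ) : ℝ) ^ (γ - 1) * (n + 1 : ℕ) := by
        rw [← Real.rpow_add_one hm.ne', sub_add_cancel]
      have e3 : (1 + γ * (-1 / ((n + 1 : ℕ) : ℝ))) * ((n + 1 : ℕ) : ℝ) ^ γ =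
          ((n + 1 : ℕ) : ℝ) ^ γ - γ * ((n + 1 : ℕ) : ℝ) ^ (γ - 1) := by
        rw [add_mul, one_mul]
        nth_rewrite 2 [e2]
        field_simp
        ring
      rw [e3] at hb
      have : 1 / γ * (n : ℝ) ^ γ ≤
          1 / γ * (((n + 1 : ℕ) : ℝ) ^ γ - γ * ((n + 1 : ℕ) : ℝ) ^ (γ - 1)) := by gcongr
      rw [mul_sub, ← mul_assoc, one_div_mul_cancel hγ.ne', one_mul] at this
      linarith

end StepSizes

/-! ### Age of the feedback in use. -/

section Source

variable {δ : ℕ → ℝ}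

lemma source_mem (δ : ℕ → ℝ) (k : ℕ) : 1 ≤ source δ k ∧ source δ k ≤ max 1 k := by
  induction k with
  | zero => simp [source]
  | succ k ih =>
    rw [source]
    split_ifs with h1 h2
    · have := (Finset.mem_filter.1 (Finset.max'_mem _ h1)).1
      rw [Finset.mem_Icc] at this
      omega
    all_goals omega

lemma source_mono (δ : ℕ → ℝ) : Monotone (source δ) := by
  refine monotone_nat_of_le_succ fun k => ?_
  rw [source]
  split_ifs <;> omega

lemma le_source {k t : ℕ} (h : t ∈ received δ (k + 1)) : t ≤ source δ (k + 1) := by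
  have hn : (received δ (k + 1)).Nonempty := ⟨t, h⟩
  have := Finset.le_max' _ _ h
  rw [source, dif_pos hn]
  split_ifs <;> omega

/-- Feedback from `τ = ⌊t - D t^α⌋` has arrived by time `t`, and the source never moves back.
Rounding costs at most `1 ≤ t^α`; if `τ` would be below `1`, the default source `1` suffices. -/
lemma sub_source_le {α D : ℝ} (hα0 : 0 ≤ α) (hD : 0 < D) (hd0 : ∀ k, 1 ≤ k → 0 ≤ δ k)
    (hd : ∀ k, 1 ≤ k → δ k ≤ D * (k : ℝ) ^ α) {t : ℕ} (ht : 1 ≤ t) :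
    (t : ℝ) - source δ t ≤ (D + 1) * (t : ℝ) ^ α := by
  have ht1 : (1 : ℝ) ≤ t := by exact_mod_cast ht
  have hpow : 1 ≤ (t : ℝ) ^ α := Real.one_le_rpow ht1 hα0
  rcases lt_or_ge ((t : ℝ) - D * (t : ℝ) ^ α) 1 with h | h
  · have : (1 : ℝ) ≤ source δ t := by exact_mod_cast (source_mem δ t).1
    linarith
  · obtain ⟨τ, hτ⟩ : ∃ τ, τ = ⌊(t : ℝ) - D * (t : ℝ) ^ α⌋₊ := ⟨_, rfl⟩
    have hτ1 : 1 ≤ τ := hτ ▸ Nat.le_floor (by exact_mod_cast h)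
    have hτle : (τ : ℝ) ≤ t - D * (t : ℝ) ^ α := hτ ▸ Nat.floor_le (by linarith)
    have hτlt : (t : ℝ) - D * (t : ℝ) ^ α < τ + 1 := hτ ▸ Nat.lt_floor_add_one _
    have hδ : δ τ ≤ D * (t : ℝ) ^ α := (hd τ hτ1).trans (by
      have : (τ : ℝ) ≤ t := by nlinarith
      gcongr)
    have hδ0 := hd0 τ hτ1
    have hτ1' : (1 : ℝ) ≤ τ := by exact_mod_cast hτ1
    -- The arrival iteration is the ceiling of `τ + δ τ`.
    obtain ⟨j, hj⟩ : ∃ j, ⌈(τ : ℝ) + δ τ⌉₊ = j + 1 :=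
      Nat.exists_eq_succ_of_ne_zero (Nat.ceil_pos.2 (by linarith)).ne'
    have hjt : j + 1 ≤ t := hj ▸ Nat.ceil_le.2 (by linarith)
    have hle : (τ : ℝ) + δ τ ≤ (j + 1 : ℕ) := hj ▸ Nat.le_ceil _
    have hlt : ((j + 1 : ℕ) : ℝ) < τ + δ τ + 1 := hj ▸ Nat.ceil_lt_add_one (by linarith)
    have hmem : τ ∈ received δ (j + 1) := by
      refine Finset.mem_filter.2 ⟨Finset.mem_Icc.2 ⟨hτ1, ?_⟩, by linarith, hle⟩
      have : (τ : ℝ) ≤ (j + 1 : ℕ) := by linarith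
      exact_mod_cast this
    have : (τ : ℝ) ≤ source δ t := by
      exact_mod_cast (le_source hmem).trans (source_mono δ hjt)
    nlinarith

end Source

/-! ### Convexity, derivatives within a set, and regret. -/

section Convex

variable {V : Type*} [NormedAddCommGroup V] [NormedSpace ℝ V] {S : Set V}

lemma _root_.ConvexOn.apply_sub_le_of_hasFDerivWithinAt {f : V → ℝ} (hf : ConvexOn ℝ S f)
    {f' : V →L[ℝ] ℝ} {y u : V} (hy : y ∈ S) (hu : u ∈ S) (h : HasFDerivWithinAt f f' S y) :
    f' (u - y) ≤ f u - f y := by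
  have hmaps : Set.MapsTo (AffineMap.lineMap y u : ℝ → V) (Set.Icc 0 1) S := fun t ht =>
    hf.1.lineMap_mem hy hu ht
  have hc : ConvexOn ℝ (Set.Icc (0 : ℝ) 1) (f ∘ (AffineMap.lineMap y u : ℝ →ᵃ[ℝ] V)) :=
    (hf.comp_affineMap _).subset hmaps (convex_Icc 0 1)
  have hd : HasDerivWithinAt (f ∘ (AffineMap.lineMap y u : ℝ →ᵃ[ℝ] V)) (f' (u - y))
      (Set.Icc (0 : ℝ) 1) 0 :=
    HasFDerivWithinAt.comp_hasDerivWithinAt (t := S) 0 (by simpa using h)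
      AffineMap.hasDerivWithinAt_lineMap hmaps
  simpa [slope_def_field] using hc.le_slope_of_hasDerivWithinAt (Set.left_mem_Icc.2 zero_le_one)
    (Set.right_mem_Icc.2 zero_le_one) zero_lt_one hd

/-- `S` may have empty interior, so derivatives within it need not be unique; they still agree on
the directions that `S` spans, which is all that is needed. -/
lemma _root_.Convex.hasFDerivWithinAt_apply_sub_eq (hS : Convex ℝ S) {f : V → ℝ}
    {f₁ f₂ : V →L[ℝ] ℝ} {x : V} (hx : x ∈ S) (h₁ : HasFDerivWithinAt f f₁ S x)
    (h₂ : HasFDerivWithinAt f f₂ S x) {u w : V} (hu : u ∈ S) (hw : w ∈ S) :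
    f₁ (u - w) = f₂ (u - w) := by
  have key : ∀ u ∈ S, f₁ (u - x) = f₂ (u - x) := fun u hu =>
    h₁.unique_on h₂ (mem_tangentConeAt_of_segment_subset (hS.segment_subset hx hu))
  rw [← sub_sub_sub_cancel_right u w x, map_sub, map_sub f₂, key u hu, key w hw]

lemma exists_seminorm_sub_le [FiniteDimensional ℝ V] (p : Seminorm ℝ V)
    (hS : Bornology.IsBounded S) : ∃ R, 0 ≤ R ∧ ∀ u ∈ S, ∀ w ∈ S, p (u - w) ≤ R := by
  have hp : Continuous p :=
    continuousOn_univ.1 (p.convexOn.continuousOn isOpen_univ)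
  obtain ⟨M, hM⟩ := (hS.isCompact_closure.image_of_continuousOn hp.continuousOn).isBounded.bddAbove
  have hM' : ∀ u ∈ S, p u ≤ M := fun u hu => hM (Set.mem_image_of_mem _ (subset_closure hu))
  refine ⟨2 * |M|, by positivity, fun u hu w hw => ?_⟩
  have := map_sub_le_add p u w
  linarith [hM' u hu, hM' w hw, le_abs_self M]

/-- Be-the-leader: `v t` is optimal for the losses up to and including `h t`, so no stability term
appears. -/
lemma sum_mul_apply_sub_le {ψ : V → ℝ} {a : ℕ → ℝ} {v : ℕ → V} {z h : ℕ → V →L[ℝ] ℝ}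
    (hz : ∀ k, z (k + 1) = z k - a (k + 1) • h (k + 1))
    (hv : ∀ k, 1 ≤ k → v k ∈ mirrorMap S ψ (z k)) {c : ℝ} (hc : ∀ u ∈ S, c ≤ ψ u - z 0 u)
    {u : V} (hu : u ∈ S) (k : ℕ) :
    ∑ t ∈ Finset.Icc 1 k, a t * h t (v t - u) ≤ ψ u - z 0 u - c := by
  -- Quantified over all `w`, because the induction uses the previous bound at `w = v (k + 1)`.
  have hlead : ∀ k, ∀ w ∈ S, c + ∑ t ∈ Finset.Icc 1 k, a t * h t (v t) ≤ ψ w - z k w := by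
    intro k
    induction k with
    | zero => simpa using hc
    | succ k ih =>
      intro w hw
      obtain ⟨hvS, hvmax⟩ := hv (k + 1) (by omega)
      have h1 : z (k + 1) w - ψ w ≤ z (k + 1) (v (k + 1)) - ψ (v (k + 1)) := hvmax hw
      have h2 := ih _ hvS
      have h3 : z (k + 1) (v (k + 1)) = z k (v (k + 1)) - a (k + 1) * h (k + 1) (v (k + 1)) := by
        simp [hz k]
      rw [Finset.sum_Icc_succ_top (by omega)]
      linarith
  have hzk : ∀ k, z k u = z 0 u - ∑ t ∈ Finset.Icc 1 k, a t * h t u := by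
    intro k
    induction k with
    | zero => simp
    | succ k ih =>
      rw [Finset.sum_Icc_succ_top (by omega), hz k]
      simp [ih]
      ring
  have h1 := hlead k u hu
  simp only [map_sub, mul_sub, Finset.sum_sub_distrib]
  linarith [hzk k]

end Convex

/-! ### Averages, extrapolations and their distance. -/

section Averages

variable {V : Type*} [AddCommGroup V] [Module ℝ V] {S : Set V} {a : ℕ → ℝ} {x y v : ℕ → V}

lemma average_mem (hS : Convex ℝ S) (ha : ∀ k, 1 ≤ k → 0 < a k) (hv : ∀ k, 1 ≤ k → v k ∈ S)
    (hy : ∀ k, y (k + 1) = (cumStep a k / cumStep a (k + 1)) • y k +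
      (a (k + 1) / cumStep a (k + 1)) • v (k + 1)) {k : ℕ} (hk : 1 ≤ k) : y k ∈ S := by
  induction k, hk using Nat.le_induction with
  | base =>
    have h := ha 1 le_rfl
    -- `A_0 = 0` removes `y 0`, which need not lie in `S`.
    have : y 1 = v 1 := by
      have := hy 0
      simpa [cumStep_zero, cumStep, h.ne'] using this
    exact this ▸ hv 1 le_rfl
  | succ k hk ih =>
    rw [hy]
    have hA := cumStep_succ_pos ha k
    refine hS ih (hv _ (by omega)) (div_nonneg (cumStep_nonneg ha k) hA.le)
      (div_nonneg (ha _ (by omega)).le hA.le) ?_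
    rw [← add_div, ← cumStep_succ, div_self hA.ne']

lemma extrapolation_mem (hS : Convex ℝ S) (ha : ∀ k, 1 ≤ k → 0 < a k)
    (hv : ∀ k, 1 ≤ k → v k ∈ S) (hyS : ∀ k, 1 ≤ k → y k ∈ S) (hx1 : x 1 ∈ S)
    (hx : ∀ k, 1 ≤ k → x (k + 1) = (cumStep a k / cumStep a (k + 1)) • y k +
      (a (k + 1) / cumStep a (k + 1)) • v k) {k : ℕ} (hk : 1 ≤ k) : x k ∈ S := by
  obtain ⟨k, rfl⟩ := Nat.exists_eq_add_of_le' hk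
  rcases Nat.eq_zero_or_pos k with rfl | hk
  · exact hx1
  · rw [hx k hk]
    have hA := cumStep_succ_pos ha k
    refine hS (hyS k hk) (hv k hk) (div_nonneg (cumStep_nonneg ha k) hA.le)
      (div_nonneg (ha _ (by omega)).le hA.le) ?_
    rw [← add_div, ← cumStep_succ, div_self hA.ne']

/-- For `s > 1`, `y s` and `x s` differ only in the mirror point they mix in, with weight `a_s/A_s`.
Each later average moves by `a_r/A_r` times a difference of points of `S`. -/
lemma seminorm_average_sub_extrapolation_le (ha : ∀ k, 1 ≤ k → 0 < a k)
    (hv : ∀ k, 1 ≤ k → v k ∈ S) (hyS : ∀ k, 1 ≤ k → y k ∈ S) (hx1 : x 1 ∈ S)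
    (hy : ∀ k, y (k + 1) = (cumStep a k / cumStep a (k + 1)) • y k +
      (a (k + 1) / cumStep a (k + 1)) • v (k + 1))
    (hx : ∀ k, 1 ≤ k → x (k + 1) = (cumStep a k / cumStep a (k + 1)) • y k +
      (a (k + 1) / cumStep a (k + 1)) • v k)
    (p : Seminorm ℝ V) {R : ℝ} (hR : ∀ u ∈ S, ∀ w ∈ S, p (u - w) ≤ R) {s t : ℕ} (hs : 1 ≤ s)
    (hst : s ≤ t) :
    p (y t - x s) ≤ ∑ r ∈ Finset.Icc s t, a r / cumStep a r * R := by
  have hq : ∀ k, 0 ≤ a (k + 1) / cumStep a (k + 1) := fun k =>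
    div_nonneg (ha _ (by omega)).le (cumStep_succ_pos ha k).le
  have hsplit : ∀ k, cumStep a k / cumStep a (k + 1) = 1 - a (k + 1) / cumStep a (k + 1) := by
    intro k
    rw [eq_sub_iff_add_eq, ← add_div, ← cumStep_succ, div_self (cumStep_succ_pos ha k).ne']
  have hsmul : ∀ k, ∀ u ∈ S, ∀ w ∈ S, p ((a (k + 1) / cumStep a (k + 1)) • (u - w)) ≤
      a (k + 1) / cumStep a (k + 1) * R := by
    intro k u hu w hw
    rw [map_smul_eq_mul, Real.norm_of_nonneg (hq k)]
    exact mul_le_mul_of_nonneg_left (hR u hu w hw) (hq k)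
  induction t, hst using Nat.le_induction with
  | base =>
    obtain ⟨k, rfl⟩ := Nat.exists_eq_add_of_le' hs
    rw [Finset.Icc_self, Finset.sum_singleton]
    rcases Nat.eq_zero_or_pos k with rfl | hk
    · have : a 1 / cumStep a 1 = 1 := by simp [cumStep, (ha 1 le_rfl).ne']
      simpa [this] using hR _ (hyS 1 le_rfl) _ hx1
    · have : y (k + 1) - x (k + 1) =
          (a (k + 1) / cumStep a (k + 1)) • (v (k + 1) - v k) := by
        rw [hy k, hx k hk, smul_sub]; abel
      rw [this]
      exact hsmul k _ (hv _ (by omega)) _ (hv k hk)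
  | succ t hst ih =>
    rw [Finset.sum_Icc_succ_top (by omega)]
    have : y (t + 1) - x s =
        (y t - x s) + (a (t + 1) / cumStep a (t + 1)) • (v (t + 1) - y t) := by
      rw [hy t, hsplit t]; module
    rw [this]
    exact (map_add_le_add p _ _).trans
      (add_le_add ih (hsmul t _ (hv _ (by omega)) _ (hyS t (hs.trans hst))))

end Averages

/-- The recursion for `y` writes `a_{k+1} (v_{k+1} - u)` through `u - y_{k+1}` and `y_k - y_{k+1}`;
the gradient inequality at `y_{k+1}` bounds both. -/
lemma cumStep_mul_gap_le {V : Type*} [NormedAddCommGroup V] [NormedSpace ℝ V] {S : Set V}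
    {a : ℕ → ℝ} {y v : ℕ → V} {f : V → ℝ} (hf : ConvexOn ℝ S f) {G : V → V →L[ℝ] ℝ}
    (hG : ∀ x ∈ S, HasFDerivWithinAt f (G x) S x) (ha : ∀ k, 1 ≤ k → 0 < a k)
    (hyS : ∀ k, 1 ≤ k → y k ∈ S)
    (hy : ∀ k, y (k + 1) = (cumStep a k / cumStep a (k + 1)) • y k +
      (a (k + 1) / cumStep a (k + 1)) • v (k + 1)) {u : V} (hu : u ∈ S) (k : ℕ) :
    cumStep a k * (f (y k) - f u) ≤ ∑ t ∈ Finset.Icc 1 k, a t * G (y t) (v t - u) := by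
  induction k with
  | zero => simp [cumStep_zero]
  | succ k ih =>
    have hyk := hyS (k + 1) (by omega)
    have hA := cumStep_succ_pos ha k
    have h1 : G (y (k + 1)) (u - y (k + 1)) ≤ f u - f (y (k + 1)) :=
      hf.apply_sub_le_of_hasFDerivWithinAt hyk hu (hG _ hyk)
    have h2 : cumStep a k * G (y (k + 1)) (y k - y (k + 1)) ≤
        cumStep a k * (f (y k) - f (y (k + 1))) := by
      rcases Nat.eq_zero_or_pos k with rfl | hk
      · simp [cumStep_zero]
      · exact mul_le_mul_of_nonneg_left (hf.apply_sub_le_of_hasFDerivWithinAt hyk (hyS k hk)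
          (hG _ hyk)) (cumStep_nonneg ha k)
    have h3 : a (k + 1) • (v (k + 1) - u) =
        -(a (k + 1) • (u - y (k + 1)) + cumStep a k • (y k - y (k + 1))) := by
      have : cumStep a (k + 1) • y (k + 1) = cumStep a k • y k + a (k + 1) • v (k + 1) := by
        rw [hy k, smul_add, smul_smul, smul_smul, mul_div_cancel₀ _ hA.ne',
          mul_div_cancel₀ _ hA.ne']
      rw [cumStep_succ, add_smul] at this
      rw [smul_sub, eq_sub_of_add_eq' this.symm]
      module
    have h4 := congrArg (G (y (k + 1))) h3
    simp only [map_neg, map_add, map_smul, smul_eq_mul] at h4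
    rw [Finset.sum_Icc_succ_top (by omega), h4, cumStep_succ]
    have := mul_le_mul_of_nonneg_left h1 (ha (k + 1) (by omega)).le
    linarith

lemma update_mem_jointSpace {ι : Type*} [DecidableEq ι] {E : ι → Type*}
    [∀ i, NormedAddCommGroup (E i)] {X : ∀ i, Set (E i)} {x : ∀ i, E i} (hx : x ∈ jointSpace X) {i : ι}
    {u : E i} (hu : u ∈ X i) : Function.update x i u ∈ jointSpace X := by
  intro j _
  rcases eq_or_ne j i with rfl | hij
  · simpa using hu
  · simpa [hij] using hx j trivial

/-! ### Partial gradients in a potential game. -/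

section Game

variable {ι : Type*} [DecidableEq ι] {E : ι → Type*} [∀ i, NormedAddCommGroup (E i)]
  [∀ i, NormedSpace ℝ (E i)] {X : ∀ i, Set (E i)}

/-- A single block is the difference of two joint strategies that differ in one coordinate, so the
joint diameter applies. -/
lemma seminorm_single_sub_le {p : Seminorm ℝ (∀ i, E i)} {R : ℝ}
    (hR : ∀ u ∈ jointSpace X, ∀ w ∈ jointSpace X, p (u - w) ≤ R) {u w : ∀ i, E i}
    (hu : u ∈ jointSpace X) (hw : w ∈ jointSpace X) (i : ι) :
    p (Pi.single i (u i - w i)) ≤ R := by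
  have : Pi.single i (u i - w i) = Function.update w i (u i) - w := by
    ext j
    rcases eq_or_ne j i with rfl | hij
    · simp
    · simp [hij]
  rw [this]
  exact hR _ (update_mem_jointSpace hw (hu i trivial)) _ hw

/-- Along player `i`'s own strategies `J i` and `Φ` differ by a constant. -/
lemma IsPotential.partialDeriv_apply_sub_eq [Fintype ι] {J : ι → (∀ i, E i) → ℝ}
    {Φ : (∀ i, E i) → ℝ} (hΦ : IsPotential X J Φ) {x : ∀ i, E i} (hx : x ∈ jointSpace X)
    {G : (∀ i, E i) →L[ℝ] ℝ} (hG : HasFDerivWithinAt Φ G (jointSpace X) x) {i : ι}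
    (hXi : Convex ℝ (X i)) {g : E i →L[ℝ] ℝ}
    (hg : HasFDerivWithinAt (fun u => J i (Function.update x i u)) g (X i) (x i)) {u w : E i}
    (hu : u ∈ X i) (hw : w ∈ X i) : g (u - w) = G (Pi.single i (u - w)) := by
  have hxi : x i ∈ X i := hx i trivial
  have h1 : HasFDerivWithinAt (fun u => Φ (Function.update x i u))
      (G.comp (.pi (Pi.single i (.id ℝ (E i))))) (X i) (x i) := by
    refine HasFDerivWithinAt.comp (t := jointSpace X) (x i) (by simpa using hG)
      (hasFDerivAt_update x (x i)).hasFDerivWithinAt fun u hu => update_mem_jointSpace hx hu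
  have h2 : HasFDerivWithinAt (fun u => J i (Function.update x i u))
      (G.comp (.pi (Pi.single i (.id ℝ (E i))))) (X i) (x i) := by
    refine (h1.add_const (J i (Function.update x i (x i)) - Φ (Function.update x i (x i)))).congr
      (fun u hu => ?_) (by ring)
    have := hΦ i x hx u hu (x i) hxi
    linarith
  rw [hXi.hasFDerivWithinAt_apply_sub_eq hxi hg h2 hu hw, ContinuousLinearMap.comp_apply]
  congr 1
  ext j
  rcases eq_or_ne j i with rfl | hij
  · simp
  · simp [hij]

lemma exists_forall_le_sub {V : Type*} [NormedAddCommGroup V] [NormedSpace ℝ V]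
    [FiniteDimensional ℝ V] {S : Set V} (hc : IsClosed S) (hb : Bornology.IsBounded S) {ψ : V → ℝ}
    (hψ : ContinuousOn ψ S) (z : V →L[ℝ] ℝ) : ∃ c, ∀ u ∈ S, c ≤ ψ u - z u := by
  obtain ⟨c, hc⟩ := ((Metric.isCompact_of_isClosed_isBounded hc hb).image_of_continuousOn
    (hψ.sub z.continuous.continuousOn)).isBounded.bddBelow
  exact ⟨c, fun u hu => hc (Set.mem_image_of_mem _ hu)⟩

end Game

/-- The total step-size weight of the iterations between a feedback and its use vanishes at the
rate `t ^ (α - 1)`. -/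
lemma sum_stepSize_div_cumStep_mul_le {a₀ β α D R : ℝ} (ha₀ : 0 < a₀) (hβ1 : β ≤ 1)
    (hα0 : 0 ≤ α) (hR : 0 ≤ R) {s t : ℕ} (hs : 1 ≤ s) (hst : s ≤ t)
    (hdelay : (t : ℝ) - s ≤ (D + 1) * (t : ℝ) ^ α) (hlarge : (D + 1) * (t : ℝ) ^ α ≤ t / 2) :
    ∑ r ∈ Finset.Icc s t,
      stepSize a₀ β r / cumStep (stepSize a₀ β) r * R ≤ 4 * (D + 2) * R * (t : ℝ) ^ (α - 1) := by
  have hs0 : (0 : ℝ) < s := by exact_mod_cast hs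
  have ht1 : (1 : ℝ) ≤ t := by exact_mod_cast hs.trans hst
  have hpow : 1 ≤ (t : ℝ) ^ α := Real.one_le_rpow ht1 hα0
  have hterm : ∀ r ∈ Finset.Icc s t,
      stepSize a₀ β r / cumStep (stepSize a₀ β) r * R ≤ 4 / t * R := by
    intro r hr
    obtain ⟨h1, -⟩ := Finset.mem_Icc.1 hr
    have h1' : (s : ℝ) ≤ r := by exact_mod_cast h1
    refine mul_le_mul_of_nonneg_right
      ((stepSize_div_cumStep_le ha₀ hβ1 (hs.trans h1)).trans ?_) hR
    -- The two delay hypotheses give `r ≥ s ≥ t/2`, hence `2/r ≤ 4/t`.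
    rw [div_le_div_iff₀ (by linarith) (by linarith)]
    linarith
  have h := Finset.sum_le_card_nsmul _ _ _ hterm
  rw [Nat.card_Icc, nsmul_eq_mul, Nat.cast_sub (by omega)] at h
  refine h.trans ?_
  have e : (t : ℝ) ^ (α - 1) = (t : ℝ) ^ α / t := by
    rw [Real.rpow_sub_one (by linarith)]
  have h2 : ((t + 1 : ℕ) : ℝ) - s ≤ (D + 2) * (t : ℝ) ^ α := by push_cast; linarith
  calc (((t + 1 : ℕ) : ℝ) - s) * (4 / t * R) ≤ (D + 2) * (t : ℝ) ^ α * (4 / t * R) := by gcongr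
    _ = _ := by rw [e]; ring

/-! ### Error of the delayed gradients along a run. -/

section Run

variable {ι : Type*} [DecidableEq ι] {E : ι → Type*} [∀ i, NormedAddCommGroup (E i)]
  [∀ i, NormedSpace ℝ (E i)] {X : ∀ i, Set (E i)} {J : ι → (∀ i, E i) → ℝ} {ψ : ∀ i, E i → ℝ}
  {a : ℕ → ℝ} {d : ι → ℕ → ℝ} {x y v : ℕ → ∀ i, E i} {z g : ℕ → ∀ i, E i →L[ℝ] ℝ}

lemma IsRun.v_mem (h : IsRun X J ψ a d x y v z g) (k : ℕ) (hk : 1 ≤ k) : v k ∈ jointSpace X :=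
  fun i _ => (h.mirror k hk i).1

lemma IsRun.x_one_mem (h : IsRun X J ψ a d x y v z g) : x 1 ∈ jointSpace X :=
  h.x_one ▸ h.x_zero_mem

lemma IsRun.y_succ (h : IsRun X J ψ a d x y v z g) (k : ℕ) :
    y (k + 1) = (cumStep a k / cumStep a (k + 1)) • y k +
      (a (k + 1) / cumStep a (k + 1)) • v (k + 1) :=
  funext (h.y_step k)

lemma IsRun.x_succ (h : IsRun X J ψ a d x y v z g) (k : ℕ) (hk : 1 ≤ k) :
    x (k + 1) = (cumStep a k / cumStep a (k + 1)) • y k + (a (k + 1) / cumStep a (k + 1)) • v k :=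
  funext (h.x_step k hk)

lemma IsRun.y_mem (h : IsRun X J ψ a d x y v z g) (hX : Convex ℝ (jointSpace X))
    (ha : ∀ k, 1 ≤ k → 0 < a k) (k : ℕ) (hk : 1 ≤ k) : y k ∈ jointSpace X :=
  average_mem hX ha h.v_mem h.y_succ hk

lemma IsRun.x_mem (h : IsRun X J ψ a d x y v z g) (hX : Convex ℝ (jointSpace X))
    (ha : ∀ k, 1 ≤ k → 0 < a k) (k : ℕ) (hk : 1 ≤ k) : x k ∈ jointSpace X :=
  extrapolation_mem hX ha h.v_mem (h.y_mem hX ha) h.x_one_mem h.x_succ hk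

lemma IsRun.seminorm_y_sub_x_source_le {a₀ β α D R : ℝ}
    (h : IsRun X J ψ (stepSize a₀ β) d x y v z g) (hX : Convex ℝ (jointSpace X)) (ha₀ : 0 < a₀)
    (hβ1 : β ≤ 1) (hα0 : 0 ≤ α) (hD : 0 < D) (hd0 : ∀ i k, 1 ≤ k → 0 ≤ d i k)
    (hd : ∀ i k, 1 ≤ k → d i k ≤ D * (k : ℝ) ^ α) {p : Seminorm ℝ (∀ i, E i)} (hR0 : 0 ≤ R)
    (hR : ∀ u ∈ jointSpace X, ∀ w ∈ jointSpace X, p (u - w) ≤ R) (i : ι) {t : ℕ} (ht : 1 ≤ t) :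
    p (y t - x (source (d i) t)) ≤ 4 * (D + 2) * R * (t : ℝ) ^ (α - 1) := by
  have ha : ∀ k, 1 ≤ k → 0 < stepSize a₀ β k := fun k hk => stepSize_pos ha₀ hk
  obtain ⟨hs1, hs2⟩ := source_mem (d i) t
  rw [max_eq_right ht] at hs2
  -- If the lag bound exceeds `t/2`, then `t^(α-1)` is bounded below and the diameter `R` itself is
  -- within the claimed bound.
  rcases le_total ((D + 1) * (t : ℝ) ^ α) (t / 2) with hlarge | hsmall
  · exact (seminorm_average_sub_extrapolation_le ha h.v_mem (h.y_mem hX ha) h.x_one_mem h.y_succ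
      h.x_succ p hR hs1 hs2).trans (sum_stepSize_div_cumStep_mul_le ha₀ hβ1 hα0 hR0 hs1 hs2
        (sub_source_le hα0 hD (hd0 i) (hd i) ht) hlarge)
  · refine (hR _ (h.y_mem hX ha t ht) _ (h.x_mem hX ha _ hs1)).trans ?_
    have ht0 : (0 : ℝ) < t := by exact_mod_cast ht
    have h0 : 0 < (t : ℝ) ^ (α - 1) := by positivity
    have e : (t : ℝ) ^ α = (t : ℝ) ^ (α - 1) * t := by
      rw [← Real.rpow_add_one ht0.ne', sub_add_cancel]
    rw [e, ← mul_assoc, div_eq_inv_mul] at hsmall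
    have h1 := le_of_mul_le_mul_right hsmall ht0
    have h2 : 1 ≤ 4 * (D + 2) * (t : ℝ) ^ (α - 1) := by nlinarith
    nlinarith [mul_le_mul_of_nonneg_right h2 hR0]

/-- Players use feedback of different ages, so the gradient is split into blocks and each is
compared with its own stale iterate; hence the factor `Fintype.card ι`. -/
lemma IsRun.gradient_apply_sub_le [Fintype ι] {Φ : (∀ i, E i) → ℝ} {a₀ β α D R L : ℝ}
    (h : IsRun X J ψ (stepSize a₀ β) d x y v z g) (hXi : ∀ i, Convex ℝ (X i))
    (hΦ : IsPotential X J Φ) {G : (∀ i, E i) → (∀ i, E i) →L[ℝ] ℝ}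
    (hG : ∀ x ∈ jointSpace X, HasFDerivWithinAt Φ (G x) (jointSpace X) x)
    {p : Seminorm ℝ (∀ i, E i)} (hL : 0 < L)
    (hGL : ∀ x ∈ jointSpace X, ∀ x' ∈ jointSpace X, ∀ h,
      |(G x - G x') h| ≤ L * p (x - x') * p h) (ha₀ : 0 < a₀)
    (hβ1 : β ≤ 1) (hα0 : 0 ≤ α) (hD : 0 < D) (hd0 : ∀ i k, 1 ≤ k → 0 ≤ d i k)
    (hd : ∀ i k, 1 ≤ k → d i k ≤ D * (k : ℝ) ^ α) (hR0 : 0 ≤ R)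
    (hR : ∀ u ∈ jointSpace X, ∀ w ∈ jointSpace X, p (u - w) ≤ R) {u : ∀ i, E i}
    (hu : u ∈ jointSpace X) {t : ℕ} (ht : 1 ≤ t) :
    G (y t) (v t - u) ≤ ∑ i, g (source (d i) t) i (v t i - u i) +
      Fintype.card ι * (L * (4 * (D + 2) * R) * R) * (t : ℝ) ^ (α - 1) := by
  have ha : ∀ k, 1 ≤ k → 0 < stepSize a₀ β k := fun k hk => stepSize_pos ha₀ hk
  have hX : Convex ℝ (jointSpace X) := convex_pi fun i _ => hXi i
  have hv := h.v_mem t ht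
  have hyt := h.y_mem hX ha t ht
  have hi : ∀ i, G (y t) (Pi.single i (v t i - u i)) ≤ g (source (d i) t) i (v t i - u i) +
      L * (4 * (D + 2) * R * (t : ℝ) ^ (α - 1)) * R := by
    intro i
    have hs1 := (source_mem (d i) t).1
    have hxs := h.x_mem hX ha _ hs1
    rw [hΦ.partialDeriv_apply_sub_eq hxs (hG _ hxs) (hXi i) (h.feedback _ hs1 i) (hv i trivial)
      (hu i trivial)]
    have h1 := (le_abs_self _).trans (hGL _ hyt _ hxs (Pi.single i (v t i - u i)))
    have h2 : L * p (y t - x (source (d i) t)) * p (Pi.single i (v t i - u i)) ≤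
        L * (4 * (D + 2) * R * (t : ℝ) ^ (α - 1)) * R :=
      mul_le_mul (mul_le_mul_of_nonneg_left
        (h.seminorm_y_sub_x_source_le hX ha₀ hβ1 hα0 hD hd0 hd hR0 hR i ht) hL.le)
        (seminorm_single_sub_le hR hv hu i) (apply_nonneg p _) (by positivity)
    rw [sub_apply] at h1
    linarith
  have hsum : G (y t) (v t - u) = ∑ i, G (y t) (Pi.single i (v t i - u i)) := by
    rw [← map_sum, ← Finset.univ_sum_single (v t - u)]
    simp
  rw [hsum]
  refine (Finset.sum_le_sum fun i _ => hi i).trans (le_of_eq ?_)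
  rw [Finset.sum_add_distrib, Finset.sum_const, Finset.card_univ, nsmul_eq_mul]
  ring

end Run

end DelayGame

/-! ### The convergence rate. -/

theorem theorem2 {ι : Type*} [Fintype ι] [DecidableEq ι] [Nonempty ι] {E : ι → Type*}
    [∀ i, NormedAddCommGroup (E i)] [∀ i, NormedSpace ℝ (E i)]
    [∀ i, FiniteDimensional ℝ (E i)]
    -- the game
    (X : ∀ i, Set (E i)) (J : ι → (∀ i, E i) → ℝ)
    (hJ : ∀ i, ContDiffOn ℝ 1 (J i) (DelayGame.jointSpace X))
    (hX_ne : ∀ i, (X i).Nonempty) (hX_closed : ∀ i, IsClosed (X i))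
    (hX_convex : ∀ i, Convex ℝ (X i)) (hX_bdd : ∀ i, Bornology.IsBounded (X i))
    -- the potential, convex and `L`-smooth with respect to a norm `p` on the product
    (Φ : (∀ i, E i) → ℝ) (hΦ : DelayGame.IsPotential X J Φ)
    (hΦ_convex : ConvexOn ℝ (DelayGame.jointSpace X) Φ)
    (p : Seminorm ℝ (∀ i, E i)) (hp : ∀ x, p x = 0 → x = 0)
    (L : ℝ) (hL : 0 < L) (hΦ_smooth : DelayGame.IsSmoothOn p L (DelayGame.jointSpace X) Φ)
    -- the regularizers
    (ψ : ∀ i, E i → ℝ) (μ : ι → ℝ) (hμ : ∀ i, 0 < μ i)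
    (hψ_cont : ∀ i, ContinuousOn (ψ i) (X i))
    (hψ : ∀ i, StrongConvexOn (X i) (μ i) (ψ i))
    -- the delays
    (α D : ℝ) (hα0 : 0 ≤ α) (hα1 : α < 1) (hD : 0 < D)
    (d : ι → ℕ → ℝ) (hd0 : ∀ i k, 1 ≤ k → 0 ≤ d i k)
    (hd : ∀ i k, 1 ≤ k → d i k ≤ D * (k : ℝ) ^ α)
    -- the step sizes
    (a₀ β : ℝ) (ha₀ : 0 < a₀) (hβ0 : 0 ≤ β) (hβ1 : β ≤ 1) (hαβ : 0 < α + β)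
    (ha : ∀ k : ℕ, 1 ≤ k →
      DelayGame.stepSize a₀ β k ^ 2 / DelayGame.cumStep (DelayGame.stepSize a₀ β) k ≤
        Finset.univ.inf' Finset.univ_nonempty μ / L)
    -- the iterates and the minimizer
    (x y v : ℕ → ∀ i, E i) (z g : ℕ → ∀ i, E i →L[ℝ] ℝ)
    (hrun : DelayGame.IsRun X J ψ (DelayGame.stepSize a₀ β) d x y v z g)
    (xstar : ∀ i, E i) (hxstar : xstar ∈ DelayGame.jointSpace X)
    (hmin : IsMinOn Φ (DelayGame.jointSpace X) xstar) :
    (fun k : ℕ => Φ (y k) - Φ xstar) =O[atTop] fun k : ℕ => 1 / (k : ℝ) ^ (1 - α) := by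
  have hX : Convex ℝ (DelayGame.jointSpace X) := convex_pi fun i _ => hX_convex i
  have ha_pos : ∀ k, 1 ≤ k → 0 < DelayGame.stepSize a₀ β k := fun k hk =>
    DelayGame.stepSize_pos ha₀ hk
  obtain ⟨G, hG, hGL⟩ := hΦ_smooth
  obtain ⟨R, hR0, hR⟩ := DelayGame.exists_seminorm_sub_le p
    (Bornology.IsBounded.pi hX_bdd : Bornology.IsBounded (DelayGame.jointSpace X))
  choose c hc using fun i => DelayGame.exists_forall_le_sub (hX_closed i) (hX_bdd i) (hψ_cont i)
    (z 0 i)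
  obtain ⟨M, hM⟩ : ∃ M, M = Fintype.card ι * (L * (4 * (D + 2) * R) * R) := ⟨_, rfl⟩
  obtain ⟨C, hC⟩ : ∃ C, C = ∑ i, (ψ i (xstar i) - z 0 i (xstar i) - c i) := ⟨_, rfl⟩
  have hM0 : 0 ≤ M := by rw [hM]; positivity
  have hC0 : 0 ≤ C := by
    rw [hC]
    exact Finset.sum_nonneg fun i _ => sub_nonneg.2 (hc i _ (hxstar i trivial))
  have hγ : 0 < α + β := hαβ
  -- `C` is the regret and the rest the accumulated delay error; `α + β > 0` keeps the power sum
  -- free of a logarithm.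
  obtain ⟨K, hK⟩ : ∃ K, K = C + M * a₀ * (1 + 1 / (α + β)) := ⟨_, rfl⟩
  have hK0 : 0 ≤ K := by rw [hK]; positivity
  have hbound : ∀ k : ℕ, 1 ≤ k →
      DelayGame.cumStep (DelayGame.stepSize a₀ β) k * (Φ (y k) - Φ xstar) ≤
        K * (k : ℝ) ^ (α + β) := by
    intro k hk
    have hk1 : (1 : ℝ) ≤ k := by exact_mod_cast hk
    have hregret : ∑ t ∈ Finset.Icc 1 k, DelayGame.stepSize a₀ β t *
        ∑ i, g (DelayGame.source (d i) t) i (v t i - xstar i) ≤ C := by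
      simp only [Finset.mul_sum]
      rw [Finset.sum_comm, hC]
      exact Finset.sum_le_sum fun i _ => DelayGame.sum_mul_apply_sub_le
        (z := fun k => z k i) (v := fun k => v k i)
        (h := fun t => g (DelayGame.source (d i) t) i) (fun k => hrun.z_step k i)
        (fun k hk => hrun.mirror k hk i) (hc i) (hxstar i trivial) k
    have hterm : ∀ t ∈ Finset.Icc 1 k,
        DelayGame.stepSize a₀ β t * G (y t) (v t - xstar) ≤
          DelayGame.stepSize a₀ β t *
            (∑ i, g (DelayGame.source (d i) t) i (v t i - xstar i)) +
          M * a₀ * (t : ℝ) ^ (α + β - 1) := by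
      intro t ht
      have ht1 := (Finset.mem_Icc.1 ht).1
      have ht0 : (0 : ℝ) < t := by exact_mod_cast ht1
      have h1 := mul_le_mul_of_nonneg_left (hrun.gradient_apply_sub_le hX_convex hΦ hG hL hGL ha₀
        hβ1 hα0 hD hd0 hd hR0 hR hxstar ht1) (ha_pos t ht1).le
      refine h1.trans (le_of_eq ?_)
      have e : (t : ℝ) ^ (α + β - 1) = (t : ℝ) ^ β * (t : ℝ) ^ (α - 1) := by
        rw [← Real.rpow_add ht0]; ring_nf
      rw [← hM, e, mul_add, DelayGame.stepSize]
      ring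
    have h1 := DelayGame.cumStep_mul_gap_le hΦ_convex hG ha_pos (hrun.y_mem hX ha_pos)
      hrun.y_succ hxstar k
    have h2 := Finset.sum_le_sum hterm
    rw [Finset.sum_add_distrib, ← Finset.mul_sum] at h2
    have h3 := mul_le_mul_of_nonneg_left (DelayGame.sum_rpow_sub_one_le hγ k)
      (mul_nonneg hM0 ha₀.le)
    have h4 : C * 1 ≤ C * (k : ℝ) ^ (α + β) :=
      mul_le_mul_of_nonneg_left (Real.one_le_rpow hk1 hγ.le) hC0
    rw [hK]
    linarith
  refine IsBigO.of_bound (2 * K / a₀) ?_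
  filter_upwards [eventually_ge_atTop 1] with k hk
  have hk0 : (0 : ℝ) < k := by exact_mod_cast hk
  have hgap : 0 ≤ Φ (y k) - Φ xstar :=
    sub_nonneg.2 (hmin (hrun.y_mem hX ha_pos k hk))
  rw [Real.norm_of_nonneg hgap, Real.norm_of_nonneg (by positivity)]
  have h1 := (mul_le_mul_of_nonneg_right (DelayGame.le_cumStep_stepSize ha₀ hβ1 hk) hgap).trans
    (hbound k hk)
  have e : (k : ℝ) ^ (β + 1) = (k : ℝ) ^ (α + β) * (k : ℝ) ^ (1 - α) := by
    rw [← Real.rpow_add hk0]; ring_nf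
  have hp1 : 0 < (k : ℝ) ^ (α + β) := by positivity
  have hp2 : 0 < (k : ℝ) ^ (1 - α) := by positivity
  rw [e] at h1
  rw [div_mul_div_comm, mul_one, le_div_iff₀ (by positivity)]
  refine le_of_mul_le_mul_left ?_ hp1
  linarith
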